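/- Let $R$ be an associative ring with identity; modules are unital left $R$-modules. Let $\mathfrak X$ be any class of $R$-modules containing all projective $R$-modules. An $R$-module $G$ is called $\mathfrak X$-Gorenstein projective if there is an exact sequence of projective $R$-modules $\cdots\to P_1\to P_0\to P^0\to P^1\to\cdots$ that remains exact after applying $\operatorname{Hom}_R(-,X)$ for every $X\in\mathfrak X$, and such that $G\cong\operatorname{Ker}(P_0\to P^0)$; when $\mathfrak X$ is the class of projective modules, $G$ is called Gorenstein projective. For an $R$-module $M$ let $\mathfrak X\text{-}\mathrm{Gpd}(M)$ (respectively $\mathrm{Gpd}(M)$) be the least $n\ge 0$ for which there is an exact sequence $0\to G_n\to\cdots\to G_0\to M\to 0$ with all $G_i$ $\mathfrak X$-Gorenstein projective (respectively Gorenstein projective), and $\infty$ if there is no such $n$; let $\mathrm{pd}(M)$ be the projective dimension of $M$. Put $$l.\mathrm{FGPD}(R)=\sup\{\mathrm{Gpd}(M)\mid \mathrm{Gpd}(M)<\infty\},$$ $$l.\mathfrak X\text{-}\mathrm{FGPD}(R)=\sup\{\mathfrak X\text{-}\mathrm{Gpd}(M)\mid \mathfrak X\text{-}\mathrm{Gpd}(M)<\infty\},$$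 $$l.\mathrm{FPD}(R)=\sup\{\mathrm{pd}(M)\mid \mathrm{pd}(M)<\infty\},$$ the suprema being taken over all $R$-modules $M$, with values in $\{0,1,2,\dots\}\cup\{\infty\}$. Then $$l.\mathrm{FGPD}(R)=l.\mathfrak X\text{-}\mathrm{FGPD}(R)=l.\mathrm{FPD}(R).$$ -/

import Mathlib

open CategoryTheory

universe u

namespace XGorenstein

variable {R : Type u} [Ring R]

/-- An `𝔛`-complete projective resolution of the left `R`-module `G`: an exact sequence
`⋯ → P (-1) → P 0 → P 1 → P 2 → ⋯` of projective modules that stays exact after applying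
`Hom_R(-, X)` for every `X` in `𝔛`, together with an identification of `G` with
`Ker (P 0 → P 1)`. -/
structure CompleteProjectiveResolution (𝔛 : ObjectProperty (ModuleCat.{u} R))
    (G : ModuleCat.{u} R) where
  P : ℤ → ModuleCat.{u} R
  d : ∀ i : ℤ, P i →ₗ[R] P (i + 1)
  projective : ∀ i : ℤ, Module.Projective R (P i)
  exact : ∀ i : ℤ, Function.Exact (d i) (d (i + 1))
  hom_exact : ∀ X : ModuleCat.{u} R, 𝔛 X → ∀ i : ℤ,
    Function.Exact (fun g : P (i + 1 + 1) →ₗ[R] X => g ∘ₗ d (i + 1))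
      (fun f : P (i + 1) →ₗ[R] X => f ∘ₗ d i)
  kerEquiv : G ≃ₗ[R] LinearMap.ker (d 0)

/-- The class of `𝔛`-Gorenstein projective left `R`-modules. -/
def IsXGorensteinProjective (𝔛 : ObjectProperty (ModuleCat.{u} R)) :
    ObjectProperty (ModuleCat.{u} R) :=
  fun G => Nonempty (CompleteProjectiveResolution 𝔛 G)

/-- The class of projective left `R`-modules. -/
def projectives (R : Type u) [Ring R] : ObjectProperty (ModuleCat.{u} R) :=
  fun M => Module.Projective R M

/-- The class of Gorenstein projective left `R`-modules: the complete projective resolution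
has to stay exact under `Hom_R(-, Q)` for every projective `Q`. -/
def IsGorensteinProjective (R : Type u) [Ring R] : ObjectProperty (ModuleCat.{u} R) :=
  IsXGorensteinProjective (projectives R)

/-- An exact sequence `0 → G n → ⋯ → G 1 → G 0 → M → 0` with all `G i` in the class `𝒞`.
The sequence is continued by zero modules beyond degree `n`. -/
structure FiniteResolution (𝒞 : ObjectProperty (ModuleCat.{u} R)) (M : ModuleCat.{u} R)
    (n : ℕ) where
  G : ℕ → ModuleCat.{u} R
  d : ∀ i : ℕ, G (i + 1) →ₗ[R] G i
  ε : G 0 →ₗ[R] M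
  mem : ∀ i ≤ n, 𝒞 (G i)
  eq_zero : ∀ i > n, Subsingleton (G i)
  exact : ∀ i : ℕ, Function.Exact (d (i + 1)) (d i)
  exact_zero : Function.Exact (d 0) ε
  surjective : Function.Surjective ε

/-- The least length of a finite resolution of `M` by modules of the class `𝒞`, and `⊤` if
there is none. -/
noncomputable def resolutionDim (𝒞 : ObjectProperty (ModuleCat.{u} R))
    (M : ModuleCat.{u} R) : ℕ∞ :=
  sInf {d : ℕ∞ | ∃ n : ℕ, d = n ∧ Nonempty (FiniteResolution 𝒞 M n)}

/-- The `𝔛`-Gorenstein projective dimension `𝔛-Gpd(M)`. -/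
noncomputable def xGpd (𝔛 : ObjectProperty (ModuleCat.{u} R)) (M : ModuleCat.{u} R) : ℕ∞ :=
  resolutionDim (IsXGorensteinProjective 𝔛) M

/-- The Gorenstein projective dimension `Gpd(M)`. -/
noncomputable def gpd (M : ModuleCat.{u} R) : ℕ∞ :=
  resolutionDim (IsGorensteinProjective R) M

/-- The left finitistic `𝔛`-Gorenstein projective dimension of `R`. -/
noncomputable def leftXFGPD (𝔛 : ObjectProperty (ModuleCat.{u} R)) : ℕ∞ :=
  sSup {d : ℕ∞ | ∃ M : ModuleCat.{u} R, xGpd 𝔛 M = d ∧ d < ⊤}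

/-- The left finitistic Gorenstein projective dimension of `R`. -/
noncomputable def leftFGPD (R : Type u) [Ring R] : ℕ∞ :=
  sSup {d : ℕ∞ | ∃ M : ModuleCat.{u} R, gpd M = d ∧ d < ⊤}

/-- The left finitistic projective dimension of `R`. Mathlib's `projectiveDimension` takes
values in `WithBot ℕ∞` and is `⊥` exactly on zero modules; those contribute nothing to the
supremum, as they would with the convention `pd 0 = 0`. -/
noncomputable def leftFPD (R : Type u) [Ring R] : ℕ∞ :=
  sSup {d : ℕ∞ | ∃ M : ModuleCat.{u} R, projectiveDimension M = (d : WithBot ℕ∞) ∧ d < ⊤}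

end XGorenstein

/-!
The `𝔛`-Gorenstein projective modules form the largest class `𝒢` of modules of `⊥𝔛` such that every
member of `𝒢` embeds into a projective module with cokernel in `𝒢`. If `𝔛` contains the projectives,
then `𝒢` is closed under extensions; it always contains the kernels of epimorphisms from projectives
onto its members. By pushouts and pullbacks, then, `M` has an `𝔛`-Gorenstein projective resolution
of length `n` if and only if it embeds into a module `L` of projective dimension at most `n` with
cokernel in `𝒢`. Thus a bound on the finite projective dimensions bounds the finite dimensions
`𝔛-Gpd`. Conversely, if moreover `pd M` is finite, then so is the projective dimension of the
cokernel; as `𝒢 ⊆ ⊥𝔛` and `𝔛` contains the projectives, the cokernel is projective, and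
`pd M ≤ n`. Hence both finitistic dimensions have the same finite upper bounds.
-/

namespace XGorenstein

section Abelian

open Limits Abelian ZeroObject

universe w v u'

variable {C : Type u'} [Category.{v} C] [Abelian C]

section ShortExact

variable {S : ShortComplex C} (hS : S.ShortExact)

include hS

lemma shortExact_of_isPushout {A T : C} {i : S.X₁ ⟶ A} {a : S.X₂ ⟶ T} {b : A ⟶ T}
    (sq : IsPushout S.f i a b) :
    (ShortComplex.mk b (sq.desc S.g 0 (by simp)) (sq.inr_desc _ _ _)).ShortExact := by
  have := hS.mono_f
  have := hS.epi_g
  have : Mono b := (MorphismProperty.monomorphisms C).of_isPushout sq.flip hS.mono_f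
  have : Epi (sq.desc S.g (0 : A ⟶ S.X₃) (by simp)) := epi_of_epi_fac (sq.inl_desc _ _ _)
  refine ⟨ShortComplex.exact_of_g_is_cokernel _ (CokernelCofork.IsColimit.ofπ' _ _ fun t ht => ?_)⟩
  obtain ⟨l, hl⟩ := CokernelCofork.IsColimit.desc' hS.gIsCokernel (a ≫ t)
    (by dsimp only at ht; rw [sq.w_assoc, ht, comp_zero])
  exact ⟨l, sq.hom_ext ((sq.inl_desc_assoc _ _ _ _).trans hl)
    ((sq.inr_desc_assoc _ _ _ _).trans (zero_comp.trans ht.symm))⟩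

lemma shortExact_comp_of_isPushout {L T : C} {i : S.X₂ ⟶ L} [Mono i] {a : L ⟶ T} {b : S.X₃ ⟶ T}
    (sq : IsPushout i S.g a b) :
    (ShortComplex.mk (S.f ≫ i) a (by simp [sq.w])).ShortExact := by
  have := hS.mono_f
  have := hS.epi_g
  have : Mono (S.f ≫ i) := mono_comp _ _
  have : Epi a := sq.epi_inl_of_epi
  refine ⟨ShortComplex.exact_of_g_is_cokernel _ (CokernelCofork.IsColimit.ofπ' _ _ fun t ht => ?_)⟩
  obtain ⟨l, hl⟩ := CokernelCofork.IsColimit.desc' hS.gIsCokernel (i ≫ t) (by simpa using ht)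
  exact ⟨sq.desc t l hl.symm, sq.inl_desc _ _ _⟩

lemma shortExact_of_isPullback {A T : C} {p : A ⟶ S.X₃} {a : T ⟶ S.X₂} {b : T ⟶ A}
    (sq : IsPullback a b S.g p) :
    (ShortComplex.mk (sq.lift S.f 0 (by simp)) b (sq.lift_snd _ _ _)).ShortExact := by
  have := hS.mono_f
  have := hS.epi_g
  have : Epi b := (MorphismProperty.epimorphisms C).of_isPullback sq this
  have : Mono (sq.lift S.f (0 : S.X₁ ⟶ A) (by simp)) := mono_of_mono_fac (sq.lift_fst _ _ _)
  refine ⟨ShortComplex.exact_of_f_is_kernel _ (KernelFork.IsLimit.ofι' _ _ fun t ht => ?_)⟩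
  obtain ⟨l, hl⟩ := KernelFork.IsLimit.lift' hS.fIsKernel (t ≫ a)
    (by dsimp only at ht; rw [Category.assoc, sq.w, reassoc_of% ht, zero_comp])
  exact ⟨l, sq.hom_ext (by simpa using hl) (by simpa using ht.symm)⟩

lemma shortExact_comp_of_isPullback {L T : C} {p : L ⟶ S.X₂} [Epi p] {a : T ⟶ L} {b : T ⟶ S.X₁}
    (sq : IsPullback a b p S.f) :
    (ShortComplex.mk a (p ≫ S.g) (by simp [sq.w_assoc])).ShortExact := by
  have := hS.mono_f
  have := hS.epi_g
  have : Epi (p ≫ S.g) := epi_comp _ _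
  have : Mono a := sq.mono_fst_of_mono
  refine ⟨ShortComplex.exact_of_f_is_kernel _ (KernelFork.IsLimit.ofι' _ _ fun t ht => ?_)⟩
  obtain ⟨l, hl⟩ := KernelFork.IsLimit.lift' hS.fIsKernel (t ≫ p) (by simpa using ht)
  exact ⟨sq.lift t l hl.symm, sq.lift_fst _ _ _⟩

end ShortExact

lemma exists_shortExact_projective [EnoughProjectives C] (X : C) :
    ∃ (K P : C) (f : K ⟶ P) (g : P ⟶ X) (w : f ≫ g = 0),
      (ShortComplex.mk f g w).ShortExact ∧ Projective P :=
  ⟨kernel (Projective.π X), Projective.over X, kernel.ι _, Projective.π X, kernel.condition _,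
    ⟨ShortComplex.kernelSequence_exact (Projective.π X)⟩, inferInstance⟩

lemma projective_X₂_of_shortExact {S : ShortComplex C} (hS : S.ShortExact) (h₁ : Projective S.X₁)
    (h₃ : Projective S.X₃) : Projective S.X₂ :=
  projective_iff_hasProjectiveDimensionLT_one.2 (hS.hasProjectiveDimensionLT_X₂ 1
    (projective_iff_hasProjectiveDimensionLT_one.1 h₁)
    (projective_iff_hasProjectiveDimensionLT_one.1 h₃))

/-- The kernels of the epimorphisms `L ⟶ G` with `L` in `𝒜` and `G` in `ℬ`; equivalently, the
objects that embed into an object of `𝒜` with cokernel in `ℬ`. -/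
def epiKernels (𝒜 ℬ : ObjectProperty C) : ObjectProperty C :=
  fun M => ∃ (L G : C) (f : M ⟶ L) (g : L ⟶ G) (w : f ≫ g = 0),
    (ShortComplex.mk f g w).ShortExact ∧ 𝒜 L ∧ ℬ G

lemma epiKernels_mono {𝒜 𝒜' ℬ ℬ' : ObjectProperty C} (h𝒜 : 𝒜 ≤ 𝒜') (hℬ : ℬ ≤ ℬ') :
    epiKernels 𝒜 ℬ ≤ epiKernels 𝒜' ℬ' :=
  fun _ ⟨L, G, f, g, w, hS, hL, hG⟩ => ⟨L, G, f, g, w, hS, h𝒜 L hL, hℬ G hG⟩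

lemma le_epiKernels {𝒜 ℬ : ObjectProperty C} (h : ℬ 0) : 𝒜 ≤ epiKernels 𝒜 ℬ :=
  fun M hM => ⟨M, 0, 𝟙 M, 0, comp_zero,
    { exact := (ShortComplex.exact_iff_epi _ rfl).2 inferInstance }, hM, h⟩

/-- The objects that are extensions of an object of `ℬ` by an object of `𝒜`. -/
def extensions (𝒜 ℬ : ObjectProperty C) : ObjectProperty C :=
  fun B => ∃ (A D : C) (f : A ⟶ B) (g : B ⟶ D) (w : f ≫ g = 0),
    (ShortComplex.mk f g w).ShortExact ∧ 𝒜 A ∧ ℬ D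

/-- `HasResolution 𝒞 n M`: there is an exact sequence `0 ⟶ G n ⟶ ⋯ ⟶ G 0 ⟶ M ⟶ 0` with all `G i`
in `𝒞`, built by splicing short exact sequences. -/
inductive HasResolution (𝒞 : ObjectProperty C) : ℕ → ObjectProperty C
  | zero {M : C} (h : 𝒞 M) : HasResolution 𝒞 0 M
  | succ {n : ℕ} {S : ShortComplex C} (hS : S.ShortExact) (h₂ : 𝒞 S.X₂)
      (h₁ : HasResolution 𝒞 n S.X₁) : HasResolution 𝒞 (n + 1) S.X₃

lemma HasResolution.mono {𝒞 𝒞' : ObjectProperty C} (h : 𝒞 ≤ 𝒞') {n : ℕ} {M : C}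
    (hM : HasResolution 𝒞 n M) : HasResolution 𝒞' n M := by
  induction hM with
  | zero hM => exact .zero (h _ hM)
  | succ hS h₂ _ ih => exact .succ hS (h _ h₂) ih

lemma hasResolution_isProjective [EnoughProjectives C] (n : ℕ) {M : C}
    (hM : HasProjectiveDimensionLE M n) : HasResolution (isProjective C) n M := by
  induction n generalizing M with
  | zero => exact .zero ((projective_iff_hasProjectiveDimensionLE_zero M).2 hM)
  | succ n ih =>
    obtain ⟨K, P, f, g, _, hS, hP⟩ := exists_shortExact_projective M
    exact .succ hS hP (ih ((hS.hasProjectiveDimensionLT_X₃_iff n hP).1 hM))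

variable [HasExt.{w} C]

lemma exists_extension_of_subsingleton_ext {S : ShortComplex C} (hS : S.ShortExact) {Y : C}
    [Subsingleton (Ext.{w} S.X₃ Y 1)] (φ : S.X₁ ⟶ Y) : ∃ ψ : S.X₂ ⟶ Y, S.f ≫ ψ = φ := by
  obtain ⟨x, hx⟩ := Ext.contravariant_sequence_exact₁ hS Y (Ext.mk₀ φ) (add_zero 1)
    (Subsingleton.elim _ _)
  obtain ⟨ψ, rfl⟩ := (Ext.mk₀_bijective S.X₂ Y).2 x
  exact ⟨ψ, (Ext.mk₀_bijective S.X₁ Y).1 (by rw [← Ext.mk₀_comp_mk₀, hx])⟩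

lemma subsingleton_ext_one_of_exists_extension {S : ShortComplex C} (hS : S.ShortExact)
    [Projective S.X₂] {Y : C} (h : ∀ φ : S.X₁ ⟶ Y, ∃ ψ : S.X₂ ⟶ Y, S.f ≫ ψ = φ) :
    Subsingleton (Ext.{w} S.X₃ Y 1) := by
  refine subsingleton_of_forall_eq 0 fun x => ?_
  obtain ⟨x₁, rfl⟩ := Ext.contravariant_sequence_exact₃ hS Y x (Ext.eq_zero_of_projective _)
    (add_zero 1)
  obtain ⟨φ, rfl⟩ := (Ext.mk₀_bijective S.X₁ Y).2 x₁
  obtain ⟨ψ, rfl⟩ := h φ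
  rw [← Ext.mk₀_comp_mk₀, hS.extClass_comp_assoc]

lemma subsingleton_ext_X₃ {S : ShortComplex C} (hS : S.ShortExact) {Y : C} {n : ℕ}
    (h₁ : Subsingleton (Ext.{w} S.X₁ Y n)) (h₂ : Subsingleton (Ext.{w} S.X₂ Y (n + 1))) :
    Subsingleton (Ext.{w} S.X₃ Y (n + 1)) := by
  refine subsingleton_of_forall_eq 0 fun x => ?_
  obtain ⟨x₁, rfl⟩ := Ext.contravariant_sequence_exact₃ hS Y x (Subsingleton.elim _ _)
    (add_comm 1 n)
  rw [Subsingleton.elim x₁ 0, Ext.comp_zero]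

lemma subsingleton_ext_X₂ {S : ShortComplex C} (hS : S.ShortExact) {Y : C} {n : ℕ}
    (h₁ : Subsingleton (Ext.{w} S.X₁ Y n)) (h₃ : Subsingleton (Ext.{w} S.X₃ Y n)) :
    Subsingleton (Ext.{w} S.X₂ Y n) := by
  refine subsingleton_of_forall_eq 0 fun x => ?_
  obtain ⟨x₃, rfl⟩ := Ext.contravariant_sequence_exact₂ hS Y x (Subsingleton.elim _ _)
  rw [Subsingleton.elim x₃ 0, Ext.comp_zero]

lemma subsingleton_ext_X₁ {S : ShortComplex C} (hS : S.ShortExact) {Y : C} {n : ℕ}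
    (h₂ : Subsingleton (Ext.{w} S.X₂ Y n)) (h₃ : Subsingleton (Ext.{w} S.X₃ Y (n + 1))) :
    Subsingleton (Ext.{w} S.X₁ Y n) := by
  refine subsingleton_of_forall_eq 0 fun x => ?_
  obtain ⟨x₂, rfl⟩ := Ext.contravariant_sequence_exact₁ hS Y x (add_comm 1 n)
    (Subsingleton.elim _ _)
  rw [Subsingleton.elim x₂ 0, Ext.comp_zero]

/-- The left orthogonal `⊥𝔛`: the objects `G` such that `Ext (n + 1) (G, X) = 0` for all `n` and
all `X` in `𝔛`. -/
def leftExtOrthogonal (𝔛 : ObjectProperty C) : ObjectProperty C :=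
  fun G => ∀ X, 𝔛 X → ∀ n, Subsingleton (Ext.{w} G X (n + 1))

variable {𝔛 : ObjectProperty C}

lemma isProjective_le_leftExtOrthogonal (𝔛 : ObjectProperty C) :
    isProjective C ≤ leftExtOrthogonal.{w} 𝔛 :=
  fun _ hP _ _ _ => have : Projective _ := hP; Ext.subsingleton_of_projective _ _ _

instance : (leftExtOrthogonal.{w} 𝔛).IsClosedUnderExtensions where
  prop_X₂_of_shortExact hS h₁ h₃ X hX n := subsingleton_ext_X₂ hS (h₁ X hX n) (h₃ X hX n)

lemma leftExtOrthogonal_X₁ {S : ShortComplex C} (hS : S.ShortExact)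
    (h₂ : leftExtOrthogonal.{w} 𝔛 S.X₂) (h₃ : leftExtOrthogonal.{w} 𝔛 S.X₃) :
    leftExtOrthogonal.{w} 𝔛 S.X₁ :=
  fun X hX n => subsingleton_ext_X₁ hS (h₂ X hX n) (h₃ X hX (n + 1))

lemma projective_of_leftExtOrthogonal_isProjective [EnoughProjectives C] {G : C}
    (hG : leftExtOrthogonal.{w} (isProjective C) G) {n : ℕ}
    (hn : HasProjectiveDimensionLT G n) : Projective G := by
  suffices ∀ k Y, Subsingleton (Ext.{w} G Y (k + 1)) from
    projective_iff_subsingleton_ext_one.2 fun {Y} => this 0 Y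
  -- Dimension shifting in the second variable: a syzygy of `Y` moves the vanishing one degree down.
  suffices ∀ j k Y, n ≤ k + j → Subsingleton (Ext.{w} G Y (k + 1)) from
    fun k Y => this n k Y (by lia)
  intro j
  induction j with
  | zero =>
    intro k Y hk
    exact HasProjectiveDimensionLT.subsingleton G n (k + 1) (by lia) Y
  | succ j ih =>
    intro k Y hk
    obtain ⟨K, P, f, g, w, hS, hP⟩ := exists_shortExact_projective Y
    have := ih (k + 1) K (by lia)
    have := hG P hP k
    refine subsingleton_of_forall_eq 0 fun x => ?_
    obtain ⟨x₂, rfl⟩ := Ext.covariant_sequence_exact₃ G hS x rfl (Subsingleton.elim _ _)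
    rw [Subsingleton.elim x₂ 0, Ext.zero_comp]

/-- The operator `𝒢 ↦ {G ∈ ⊥𝔛 | G is the kernel of an epimorphism from a projective onto an
object of 𝒢}`. -/
def gorensteinStep (𝔛 : ObjectProperty C) : ObjectProperty C →o ObjectProperty C where
  toFun 𝒢 := leftExtOrthogonal.{w} 𝔛 ⊓ epiKernels (isProjective C) 𝒢
  monotone' _ _ h := inf_le_inf_left _ (epiKernels_mono le_rfl h)

/-- The `𝔛`-Gorenstein projective objects, as the largest class of objects of `⊥𝔛` each of which
is the kernel of an epimorphism from a projective onto an object of the class. Iterating such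
epimorphisms gives the right half of a complete resolution; no condition is needed for the left
half, since every projective resolution of an object of `⊥𝔛` stays exact under `Hom(-, X)`. -/
def xGorensteinProjective (𝔛 : ObjectProperty C) : ObjectProperty C :=
  OrderHom.gfp (gorensteinStep.{w} 𝔛)

lemma xGorensteinProjective_iff {G : C} : xGorensteinProjective.{w} 𝔛 G ↔
    leftExtOrthogonal.{w} 𝔛 G ∧ epiKernels (isProjective C) (xGorensteinProjective.{w} 𝔛) G :=
  iff_of_eq (congrFun (OrderHom.map_gfp (gorensteinStep.{w} 𝔛)).symm G)

lemma le_xGorensteinProjective {𝒢 : ObjectProperty C} (h𝔛 : 𝒢 ≤ leftExtOrthogonal.{w} 𝔛)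
    (h𝒢 : 𝒢 ≤ epiKernels (isProjective C) 𝒢) : 𝒢 ≤ xGorensteinProjective.{w} 𝔛 :=
  OrderHom.le_gfp _ (le_inf h𝔛 h𝒢)

lemma isProjective_le_xGorensteinProjective (𝔛 : ObjectProperty C) :
    isProjective C ≤ xGorensteinProjective.{w} 𝔛 :=
  le_xGorensteinProjective (isProjective_le_leftExtOrthogonal 𝔛)
    (le_epiKernels (Projective.zero_projective))

lemma epiKernels_isProjective_le_xGorensteinProjective :
    epiKernels (isProjective C) (xGorensteinProjective.{w} 𝔛) ≤ xGorensteinProjective.{w} 𝔛 :=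
  fun _ ⟨L, G, f, g, w, hS, hL, hG⟩ => xGorensteinProjective_iff.2
    ⟨leftExtOrthogonal_X₁ hS (isProjective_le_leftExtOrthogonal 𝔛 L hL)
      (xGorensteinProjective_iff.1 hG).1, L, G, f, g, w, hS, hL, hG⟩

/-- Vanishing of `Ext 1` splits a short exact sequence, and a splitting can be read backwards. -/
lemma exists_shortExact_swap {S : ShortComplex C} (hS : S.ShortExact)
    [Subsingleton (Ext.{w} S.X₃ S.X₁ 1)] :
    ∃ (s : S.X₃ ⟶ S.X₂) (r : S.X₂ ⟶ S.X₁) (w : s ≫ r = 0), (ShortComplex.mk s r w).ShortExact := by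
  obtain ⟨r, hr⟩ := exists_extension_of_subsingleton_ext hS (𝟙 S.X₁)
  have := hS.epi_g
  let σ := ShortComplex.Splitting.ofExactOfRetraction S hS.exact r hr this
  exact ⟨σ.s, σ.r, σ.s_r, ShortComplex.Splitting.shortExact
    { r := S.g, s := S.f, id := by rw [← σ.id, add_comm] }⟩

lemma extensions_xGorensteinProjective_le (h𝔛 : isProjective C ≤ 𝔛) :
    extensions (xGorensteinProjective.{w} 𝔛) (xGorensteinProjective.{w} 𝔛) ≤
      xGorensteinProjective.{w} 𝔛 := by
  refine le_xGorensteinProjective ?_ ?_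
  · rintro B ⟨A, D, f, g, w, hS, hA, hD⟩
    exact (leftExtOrthogonal.{w} 𝔛).prop_X₂_of_shortExact hS (xGorensteinProjective_iff.1 hA).1
      (xGorensteinProjective_iff.1 hD).1
  · rintro B ⟨A, D, f, g, w, hS, hA, hD⟩
    obtain ⟨-, P, A', i, p, _, hP, hP', hA'⟩ := xGorensteinProjective_iff.1 hA
    obtain ⟨hDX, Q, D', j, q, _, hQ, hQ', hD'⟩ := xGorensteinProjective_iff.1 hD
    have sq := IsPushout.of_hasPushout f i
    have hB := shortExact_of_isPushout hP sq.flip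
    have : Subsingleton (Ext.{w} D P 1) := hDX P (h𝔛 P hP') 0
    obtain ⟨s, r, _, hT⟩ := exists_shortExact_swap (shortExact_of_isPushout hS sq)
    have sqT := IsPushout.of_hasPushout s j
    have hT' := shortExact_of_isPushout hQ sqT.flip
    have := hT'.mono_f
    have sqB := IsPushout.of_hasPushout (pushout.inl s j) (sq.flip.desc p 0 (by simpa))
    exact ⟨pushout s j, _, _, _, _, shortExact_comp_of_isPushout hB sqB,
      projective_X₂_of_shortExact (shortExact_of_isPushout hT sqT) hQ' hP',
      A', D', _, _, _, shortExact_of_isPushout hT' sqB, hA', hD'⟩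

lemma isClosedUnderExtensions_xGorensteinProjective (h𝔛 : isProjective C ≤ 𝔛) :
    (xGorensteinProjective.{w} 𝔛).IsClosedUnderExtensions where
  prop_X₂_of_shortExact hS h₁ h₃ := extensions_xGorensteinProjective_le h𝔛 _
    ⟨_, _, _, _, _, hS, h₁, h₃⟩

lemma epiKernels_of_hasResolution_xGorensteinProjective (h𝔛 : isProjective C ≤ 𝔛) {n : ℕ} {M : C}
    (hM : HasResolution (xGorensteinProjective.{w} 𝔛) n M) :
    epiKernels (HasProjectiveDimensionLE · n) (xGorensteinProjective.{w} 𝔛) M := by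
  have := isClosedUnderExtensions_xGorensteinProjective.{w} h𝔛
  induction hM with
  | zero hM =>
    exact epiKernels_mono (fun X => (projective_iff_hasProjectiveDimensionLE_zero X).1) le_rfl _
      (xGorensteinProjective_iff.1 hM).2
  | @succ n S hS h₂ _ ih =>
    obtain ⟨L', G', i, p, _, hL, hL', hG'⟩ := ih
    have sq := IsPushout.of_hasPushout S.f i
    have hT := shortExact_of_isPushout hS sq
    have hT' := (xGorensteinProjective.{w} 𝔛).prop_X₂_of_shortExact
      (shortExact_of_isPushout hL sq.flip) h₂ hG'
    obtain ⟨-, P, G, j, q, _, hP, hP', hG⟩ := xGorensteinProjective_iff.1 hT'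
    have := hP.mono_f
    have sqP := IsPushout.of_hasPushout j (sq.desc S.g 0 (by simp))
    have hPLE : HasProjectiveDimensionLE P (n + 1) :=
      have : Projective P := hP'
      hasProjectiveDimensionLT_of_ge P 1 _ (by lia)
    exact ⟨_, G, _, _, _, shortExact_of_isPushout hP sqP,
      (shortExact_comp_of_isPushout hT sqP).hasProjectiveDimensionLT_X₃ _ hL' hPLE, hG⟩

lemma hasResolution_xGorensteinProjective_of_epiKernels [EnoughProjectives C] {n : ℕ} {M : C}
    (hM : epiKernels (HasProjectiveDimensionLE · n) (xGorensteinProjective.{w} 𝔛) M) :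
    HasResolution (xGorensteinProjective.{w} 𝔛) n M := by
  obtain _ | n := n
  · exact .zero (epiKernels_isProjective_le_xGorensteinProjective _ (epiKernels_mono
      (fun X => (projective_iff_hasProjectiveDimensionLE_zero X).2) le_rfl _ hM))
  · obtain ⟨L, G, f, g, _, hS, hL, hG⟩ := hM
    obtain ⟨K, Q, i, p, _, hQ, hQ'⟩ := exists_shortExact_projective L
    have := hQ.epi_g
    have sq := IsPullback.of_hasPullback p f
    exact .succ (shortExact_of_isPullback hQ sq)
      (epiKernels_isProjective_le_xGorensteinProjective _
        ⟨Q, G, _, _, _, shortExact_comp_of_isPullback hS sq, hQ', hG⟩)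
      ((hasResolution_isProjective n ((hQ.hasProjectiveDimensionLT_X₃_iff n hQ').1 hL)).mono
        (isProjective_le_xGorensteinProjective 𝔛))

lemma hasResolution_xGorensteinProjective_of_le [EnoughProjectives C] (h𝔛 : isProjective C ≤ 𝔛)
    {m n : ℕ} (hmn : m ≤ n) {M : C} (hM : HasResolution (xGorensteinProjective.{w} 𝔛) m M) :
    HasResolution (xGorensteinProjective.{w} 𝔛) n M :=
  hasResolution_xGorensteinProjective_of_epiKernels (epiKernels_mono
    (fun L (_ : HasProjectiveDimensionLE L m) => hasProjectiveDimensionLT_of_ge L (m + 1) _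
      (by lia)) le_rfl _
    (epiKernels_of_hasResolution_xGorensteinProjective h𝔛 hM))

lemma hasProjectiveDimensionLE_of_hasResolution_xGorensteinProjective [EnoughProjectives C]
    (h𝔛 : isProjective C ≤ 𝔛) {m n : ℕ} {M : C}
    (hM : HasResolution (xGorensteinProjective.{w} 𝔛) n M)
    (hm : HasProjectiveDimensionLE M m) : HasProjectiveDimensionLE M n := by
  obtain ⟨L, G, f, g, _, hS, hL, hG⟩ := epiKernels_of_hasResolution_xGorensteinProjective h𝔛 hM
  have hGm : HasProjectiveDimensionLT G (m + n + 2) := hS.hasProjectiveDimensionLT_X₃ _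
    (hasProjectiveDimensionLT_of_ge M (m + 1) _ (by lia))
    (hasProjectiveDimensionLT_of_ge L (n + 1) _ (by lia))
  have : Projective G := projective_of_leftExtOrthogonal_isProjective
    (fun P hP => (xGorensteinProjective_iff.1 hG).1 P (h𝔛 P hP)) hGm
  exact hS.hasProjectiveDimensionLT_X₁ _ hL (hasProjectiveDimensionLT_of_ge G 1 _ (by lia))

theorem forall_hasResolution_xGorensteinProjective_iff [EnoughProjectives C]
    (h𝔛 : isProjective C ≤ 𝔛) (n : ℕ) :
    (∀ M m, HasResolution (xGorensteinProjective.{w} 𝔛) m M →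
        HasResolution (xGorensteinProjective.{w} 𝔛) n M) ↔
      ∀ (M : C) (m : ℕ), HasProjectiveDimensionLE M m → HasProjectiveDimensionLE M n := by
  refine ⟨fun h M m hM => ?_, fun h M m hM => ?_⟩
  · exact hasProjectiveDimensionLE_of_hasResolution_xGorensteinProjective h𝔛 (h M m
      ((hasResolution_isProjective m hM).mono (isProjective_le_xGorensteinProjective 𝔛))) hM
  · exact hasResolution_xGorensteinProjective_of_epiKernels (epiKernels_mono
      (fun L => h L m) le_rfl _ (epiKernels_of_hasResolution_xGorensteinProjective h𝔛 hM))

end Abelian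

variable {R : Type u} [Ring R] {𝔛 : ObjectProperty (ModuleCat.{u} R)}

namespace CompleteProjectiveResolution

variable {G : ModuleCat.{u} R} (c : CompleteProjectiveResolution 𝔛 G)

/-- The kernel of the differential of a complete resolution in degree `i`. -/
abbrev cycles (i : ℤ) : ModuleCat.{u} R := ModuleCat.of R (LinearMap.ker (c.d i))

/-- The differential of a complete resolution, as a map onto the next module of cycles. -/
def toCycles (i : ℤ) : c.P i →ₗ[R] c.cycles (i + 1) :=
  (c.d i).codRestrict _ fun x => (c.exact i _).2 ⟨x, rfl⟩

/-- The short exact sequence `0 → H → P i → Ker (P (i + 1) → P (i + 2)) → 0` attached to an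
identification of `H` with the cycles in degree `i`. -/
abbrev cyclesSequence {H : ModuleCat.{u} R} {i : ℤ} (e : H ≃ₗ[R] c.cycles i) :
    ShortComplex (ModuleCat.{u} R) :=
  .mk (ModuleCat.ofHom ((LinearMap.ker (c.d i)).subtype ∘ₗ e.toLinearMap))
    (ModuleCat.ofHom (c.toCycles i)) (by ext x; exact (e x).2)

lemma shortExact_cyclesSequence {H : ModuleCat.{u} R} {i : ℤ} (e : H ≃ₗ[R] c.cycles i) :
    (c.cyclesSequence e).ShortExact := by
  refine ModuleCat.shortComplex_shortExact _ (fun x => ?_)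
    (Subtype.val_injective.comp e.injective) ?_
  · exact ⟨fun hx => ⟨e.symm ⟨x, congrArg Subtype.val hx⟩, by simp⟩,
      by rintro ⟨y, rfl⟩; exact Subtype.ext (e y).2⟩
  · rintro ⟨x, hx⟩
    obtain ⟨y, rfl⟩ := (c.exact i x).1 hx
    exact ⟨y, rfl⟩

lemma exists_extension_of_cycles {X : ModuleCat.{u} R} (hX : 𝔛 X) (i : ℤ)
    (φ : c.cycles (i + 1 + 1) →ₗ[R] X) :
    ∃ ψ : c.P (i + 1 + 1) →ₗ[R] X, ψ ∘ₗ (LinearMap.ker (c.d (i + 1 + 1))).subtype = φ := by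
  have hφ : (φ ∘ₗ c.toCycles (i + 1)) ∘ₗ c.d i = 0 := by
    ext x
    have : c.toCycles (i + 1) (c.d i x) = 0 := Subtype.ext ((c.exact i _).2 ⟨x, rfl⟩)
    simp [this]
  obtain ⟨ψ, hψ⟩ := (c.hom_exact X hX i _).1 hφ
  refine ⟨ψ, LinearMap.ext ?_⟩
  rintro ⟨x, hx⟩
  obtain ⟨y, rfl⟩ := (c.exact (i + 1) x).1 hx
  exact LinearMap.congr_fun hψ y

lemma leftExtOrthogonal_cycles (i : ℤ) : leftExtOrthogonal.{u} 𝔛 (c.cycles i) := by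
  intro X hX n
  have (j : ℤ) : Projective (c.P j) := (IsProjective.iff_projective _).1 (c.projective j)
  induction n generalizing i with
  | zero =>
    obtain ⟨j, rfl⟩ : ∃ j : ℤ, i = j + 1 + 1 + 1 := ⟨i - 3, by ring⟩
    have hS := c.shortExact_cyclesSequence (.refl R (c.cycles (j + 1 + 1)))
    refine subsingleton_ext_one_of_exists_extension hS fun φ => ?_
    obtain ⟨ψ, hψ⟩ := c.exists_extension_of_cycles hX j φ.hom
    exact ⟨ModuleCat.ofHom ψ, ModuleCat.hom_ext hψ⟩
  | succ n ih =>
    obtain ⟨j, rfl⟩ : ∃ j : ℤ, i = j + 1 := ⟨i - 1, by ring⟩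
    exact subsingleton_ext_X₃ (c.shortExact_cyclesSequence (.refl R _)) (ih j)
      (Abelian.Ext.subsingleton_of_projective _ _ _)

lemma xGorensteinProjective_cycles (i : ℤ) : xGorensteinProjective.{u} 𝔛 (c.cycles i) := by
  refine le_xGorensteinProjective (𝒢 := .ofObj c.cycles) ?_ ?_ _ (⟨i⟩)
  · rintro _ ⟨i⟩
    exact c.leftExtOrthogonal_cycles i
  rintro _ ⟨i⟩
  exact ⟨_, _, _, _, _, c.shortExact_cyclesSequence (.refl R _),
    (IsProjective.iff_projective _).1 (c.projective i), ⟨i + 1⟩⟩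

end CompleteProjectiveResolution

lemma xGorensteinProjective_of_isXGorensteinProjective {G : ModuleCat.{u} R}
    (hG : IsXGorensteinProjective 𝔛 G) : xGorensteinProjective.{u} 𝔛 G := by
  obtain ⟨c⟩ := hG
  exact epiKernels_isProjective_le_xGorensteinProjective _ ⟨_, _, _, _, _,
    c.shortExact_cyclesSequence c.kerEquiv, (IsProjective.iff_projective _).1 (c.projective 0),
    c.xGorensteinProjective_cycles (0 + 1)⟩

lemma exists_int_chain {α : Type*} {r : α → α → Prop} (hr : ∀ a, ∃ b, r a b)
    (hl : ∀ b, ∃ a, r a b) (a : α) : ∃ K : ℤ → α, K 0 = a ∧ ∀ i, r (K i) (K (i + 1)) := by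
  choose s hs using hr
  choose p hp using hl
  let K : ℤ → α
    | .ofNat n => s^[n] a
    | .negSucc n => p^[n + 1] a
  refine ⟨K, rfl, ?_⟩
  rintro (n | _ | n)
  · change r (s^[n] a) (s^[n + 1] a)
    exact Function.iterate_succ_apply' s n a ▸ hs _
  · exact hp a
  · change r (p^[n + 1 + 1] a) (p^[n + 1] a)
    exact Function.iterate_succ_apply' p (n + 1) a ▸ hp _

lemma isXGorensteinProjective_of_shortExact {K P : ℤ → ModuleCat.{u} R} {f : ∀ i, K i ⟶ P i}
    {g : ∀ i, P i ⟶ K (i + 1)} {w : ∀ i, f i ≫ g i = 0}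
    (hS : ∀ i, (ShortComplex.mk (f i) (g i) (w i)).ShortExact) (hP : ∀ i, Projective (P i))
    (hK : ∀ i X, 𝔛 X → Subsingleton (Abelian.Ext.{u} (K i) X 1)) :
    IsXGorensteinProjective 𝔛 (K 0) := by
  have hf (i : ℤ) : Function.Injective (f i) := (hS i).moduleCat_injective_f
  have hg (i : ℤ) : Function.Surjective (g i) := (hS i).moduleCat_surjective_g
  have hfg (i : ℤ) : Function.Exact (f i) (g i) :=
    (ShortComplex.ShortExact.moduleCat_exact_iff_function_exact _).1 (hS i).exact
  have hker (i : ℤ) (x : P i) : f (i + 1) (g i x) = 0 ↔ g i x = 0 := map_eq_zero_iff _ (hf _)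
  refine ⟨⟨P, fun i => (g i ≫ f (i + 1)).hom, fun i => (IsProjective.iff_projective _).2 (hP i),
    fun i x => ?_, fun X hX i φ => ⟨fun hφ => ?_, ?_⟩,
    (LinearEquiv.ofInjective (f 0).hom (hf 0)).trans (LinearEquiv.ofEq _ _ ?_)⟩⟩
  · refine (hker (i + 1) x).trans ((hfg (i + 1) x).trans ?_)
    exact ⟨fun ⟨y, hy⟩ => (hg i y).imp fun z hz => by simp [hz, hy], fun ⟨z, hz⟩ => ⟨g i z, hz⟩⟩
  · have := (hS i).epi_g
    have hφ' : f (i + 1) ≫ ModuleCat.ofHom φ = 0 := by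
      rw [← cancel_epi (g i), Limits.comp_zero, ← Category.assoc]
      exact ModuleCat.hom_ext hφ
    obtain ⟨θ, hθ⟩ := Limits.CokernelCofork.IsColimit.desc' (hS (i + 1)).gIsCokernel _ hφ'
    have := hK (i + 1 + 1 + 1) X hX
    obtain ⟨ψ, rfl⟩ := exists_extension_of_subsingleton_ext (hS (i + 1 + 1)) θ
    exact ⟨ψ.hom, congrArg ModuleCat.Hom.hom hθ⟩
  · rintro ⟨ψ, rfl⟩
    exact LinearMap.ext fun x => by simp [(hfg (i + 1)).apply_apply_eq_zero]
  · ext x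
    exact ((hker 0 x).trans (hfg 0 x)).symm

lemma isXGorensteinProjective_of_xGorensteinProjective {G : ModuleCat.{u} R}
    (hG : xGorensteinProjective.{u} 𝔛 G) : IsXGorensteinProjective 𝔛 G := by
  obtain ⟨K, hK0, hK⟩ := exists_int_chain
    (r := fun A B : (xGorensteinProjective.{u} 𝔛).FullSubcategory =>
      ∃ (P : ModuleCat.{u} R) (f : A.1 ⟶ P) (g : P ⟶ B.1) (w : f ≫ g = 0),
        (ShortComplex.mk f g w).ShortExact ∧ Projective P)
    (fun A => by
      obtain ⟨-, P, B, f, g, w, hS, hP, hB⟩ := xGorensteinProjective_iff.1 A.2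
      exact ⟨⟨B, hB⟩, P, f, g, w, hS, hP⟩)
    (fun B => by
      obtain ⟨A, P, f, g, w, hS, hP⟩ := exists_shortExact_projective B.1
      exact ⟨⟨A, epiKernels_isProjective_le_xGorensteinProjective _
        ⟨P, B.1, f, g, w, hS, hP, B.2⟩⟩, P, f, g, w, hS, hP⟩)
    ⟨G, hG⟩
  choose P f g w hS hP using hK
  have := isXGorensteinProjective_of_shortExact (K := fun i => (K i).1) hS hP
    fun i X hX => (xGorensteinProjective_iff.1 (K i).2).1 X hX 0
  rwa [hK0] at this

theorem isXGorensteinProjective_eq_xGorensteinProjective (𝔛 : ObjectProperty (ModuleCat.{u} R)) :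
    IsXGorensteinProjective 𝔛 = xGorensteinProjective.{u} 𝔛 :=
  funext fun _ => propext ⟨xGorensteinProjective_of_isXGorensteinProjective,
    isXGorensteinProjective_of_xGorensteinProjective⟩

instance : (IsXGorensteinProjective 𝔛).IsClosedUnderIsomorphisms where
  of_iso e := fun ⟨c⟩ => ⟨{ c with kerEquiv := e.symm.toLinearEquiv.trans c.kerEquiv }⟩

section FiniteResolution

variable {𝒞 : ObjectProperty (ModuleCat.{u} R)}

namespace FiniteResolution

variable {M : ModuleCat.{u} R}

/-- A module of the class, as its own resolution of length zero. -/
def single (hM : 𝒞 M) : FiniteResolution 𝒞 M 0 where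
  G i := Nat.casesOn i M fun _ => ModuleCat.of R PUnit.{u + 1}
  d _ := 0
  ε := LinearMap.id
  mem
    | 0, _ => hM
  eq_zero
    | _ + 1, _ => inferInstanceAs (Subsingleton PUnit.{u + 1})
  exact _ _ := ⟨fun _ => ⟨0, Subsingleton.elim (α := PUnit.{u + 1}) _ _⟩, fun _ => rfl⟩
  exact_zero _ := ⟨fun h => ⟨0, h.symm⟩, fun ⟨_, h⟩ => h.symm⟩
  surjective := Function.surjective_id

/-- The splice of a short exact sequence with a resolution of its kernel. -/
def splice {S : ShortComplex (ModuleCat.{u} R)} (hS : S.ShortExact) (h₂ : 𝒞 S.X₂) {n : ℕ}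
    (c : FiniteResolution 𝒞 S.X₁ n) : FiniteResolution 𝒞 S.X₃ (n + 1) where
  G i := Nat.casesOn i S.X₂ c.G
  d
    | 0 => S.f.hom ∘ₗ c.ε
    | i + 1 => c.d i
  ε := S.g.hom
  mem
    | 0, _ => h₂
    | i + 1, hi => c.mem i (by lia)
  eq_zero
    | i + 1, hi => c.eq_zero i (by lia)
  exact
    | 0 => fun x => (map_eq_zero_iff S.f.hom hS.moduleCat_injective_f).trans (c.exact_zero x)
    | i + 1 => c.exact i
  exact_zero x :=
    ((ShortComplex.ShortExact.moduleCat_exact_iff_function_exact S).1 hS.exact x).trans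
      ⟨fun ⟨y, hy⟩ => (c.surjective y).imp fun z hz => (congrArg S.f.hom hz).trans hy,
        fun ⟨z, hz⟩ => ⟨c.ε z, hz⟩⟩
  surjective := hS.moduleCat_surjective_g

/-- The truncation of a resolution, as a resolution of the kernel of its augmentation. -/
def tail {n : ℕ} (c : FiniteResolution 𝒞 M (n + 1)) :
    FiniteResolution 𝒞 (ModuleCat.of R (LinearMap.ker c.ε)) n where
  G i := c.G (i + 1)
  d i := c.d (i + 1)
  ε := (c.d 0).codRestrict _ fun x => (c.exact_zero _).2 ⟨x, rfl⟩
  mem i hi := c.mem (i + 1) (by lia)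
  eq_zero i hi := c.eq_zero (i + 1) (by lia)
  exact i := c.exact (i + 1)
  exact_zero x := Subtype.ext_iff.trans (c.exact 0 x)
  surjective := by
    rintro ⟨x, hx⟩
    obtain ⟨y, rfl⟩ := (c.exact_zero x).1 hx
    exact ⟨y, rfl⟩

lemma bijective_ε (c : FiniteResolution 𝒞 M 0) : Function.Bijective c.ε := by
  refine ⟨(injective_iff_map_eq_zero c.ε).2 fun x hx => ?_, c.surjective⟩
  obtain ⟨y, rfl⟩ := (c.exact_zero x).1 hx
  have := c.eq_zero 1 one_pos
  rw [Subsingleton.elim y 0, map_zero]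

end FiniteResolution

lemma nonempty_finiteResolution_iff [𝒞.IsClosedUnderIsomorphisms] {M : ModuleCat.{u} R} {n : ℕ} :
    Nonempty (FiniteResolution 𝒞 M n) ↔ HasResolution 𝒞 n M := by
  constructor
  · rintro ⟨c⟩
    induction n generalizing M with
    | zero =>
      exact .zero (𝒞.prop_of_iso (LinearEquiv.ofBijective c.ε c.bijective_ε).toModuleIso
        (c.mem 0 le_rfl))
    | succ n ih =>
      exact .succ (LinearMap.shortExact_shortComplexKer c.surjective) (c.mem 0 (Nat.zero_le _))
        (ih c.tail)
  · intro hM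
    induction hM with
    | zero hM => exact ⟨.single hM⟩
    | succ hS h₂ _ ih => exact ih.map (.splice hS h₂)

lemma resolutionDim_le_iff {M : ModuleCat.{u} R} {n : ℕ} :
    resolutionDim 𝒞 M ≤ n ↔ ∃ m ≤ n, Nonempty (FiniteResolution 𝒞 M m) := by
  rw [← ENat.lt_add_one_iff (ENat.natCast_ne_top n), resolutionDim, sInf_lt_iff]
  constructor
  · rintro ⟨_, ⟨m, rfl, hm⟩, hmn⟩
    exact ⟨m, by exact_mod_cast Order.le_of_lt_add_one hmn, hm⟩
  · rintro ⟨m, hmn, hm⟩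
    exact ⟨m, ⟨m, rfl, hm⟩, by exact_mod_cast Nat.lt_succ_of_le hmn⟩

end FiniteResolution

lemma projectives_eq_isProjective (R : Type u) [Ring R] :
    projectives R = isProjective (ModuleCat.{u} R) :=
  funext fun P => propext (IsProjective.iff_projective P)

lemma xGpd_le_iff (h𝔛 : projectives R ≤ 𝔛) {M : ModuleCat.{u} R} {n : ℕ} :
    xGpd 𝔛 M ≤ n ↔ HasResolution (IsXGorensteinProjective 𝔛) n M := by
  simp only [xGpd, resolutionDim_le_iff, nonempty_finiteResolution_iff]
  refine ⟨?_, fun h => ⟨n, le_rfl, h⟩⟩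
  rintro ⟨m, hmn, hm⟩
  rw [isXGorensteinProjective_eq_xGorensteinProjective] at hm ⊢
  exact hasResolution_xGorensteinProjective_of_le (projectives_eq_isProjective R ▸ h𝔛) hmn hm

lemma leftXFGPD_le_iff (h𝔛 : projectives R ≤ 𝔛) {n : ℕ} :
    leftXFGPD 𝔛 ≤ n ↔ ∀ (M : ModuleCat.{u} R) (m : ℕ),
      HasResolution (IsXGorensteinProjective 𝔛) m M →
        HasResolution (IsXGorensteinProjective 𝔛) n M := by
  simp only [leftXFGPD, sSup_le_iff, Set.mem_ofPred_eq, ← xGpd_le_iff h𝔛]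
  constructor
  · exact fun h M m hM => h _ ⟨M, rfl, hM.trans_lt (ENat.natCast_lt_top m)⟩
  · rintro h _ ⟨M, rfl, hM⟩
    exact h M _ (ENat.natCast_toNat hM.ne).ge

lemma leftFPD_le_iff {n : ℕ} : leftFPD R ≤ n ↔
    ∀ (M : ModuleCat.{u} R) (m : ℕ), HasProjectiveDimensionLE M m →
      HasProjectiveDimensionLE M n := by
  simp only [leftFPD, sSup_le_iff, Set.mem_ofPred_eq, ← projectiveDimension_le_iff]
  constructor
  · intro h M m hM
    cases hd : projectiveDimension M with
    | bot => exact bot_le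
    | coe d =>
      have hdm : d ≤ m := by exact_mod_cast hd ▸ hM
      exact_mod_cast h d ⟨M, hd, hdm.trans_lt (ENat.natCast_lt_top m)⟩
  · rintro h d ⟨M, hM, hd⟩
    lift d to ℕ using hd.ne
    exact_mod_cast hM ▸ h M d hM.le

theorem leftXFGPD_eq_leftFPD (h𝔛 : projectives R ≤ 𝔛) :
    leftXFGPD 𝔛 = leftFPD R := by
  refine eq_of_forall_ge_iff fun n => ?_
  induction n with
  | top => simp only [le_top]
  | coe n =>
    rw [leftXFGPD_le_iff h𝔛, leftFPD_le_iff, isXGorensteinProjective_eq_xGorensteinProjective]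
    exact forall_hasResolution_xGorensteinProjective_iff (projectives_eq_isProjective R ▸ h𝔛) n

end XGorenstein

theorem mainTheorem2 {R : Type u} [Ring R] (𝔛 : ObjectProperty (ModuleCat.{u} R))
    (h𝔛 : ∀ P : ModuleCat.{u} R, Module.Projective R P → 𝔛 P) :
    XGorenstein.leftFGPD R = XGorenstein.leftXFGPD 𝔛 ∧
      XGorenstein.leftXFGPD 𝔛 = XGorenstein.leftFPD R := by
  have hproj := XGorenstein.leftXFGPD_eq_leftFPD (le_refl (XGorenstein.projectives R))
  have hX := XGorenstein.leftXFGPD_eq_leftFPD h𝔛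
  exact ⟨hproj.trans hX.symm, hX⟩
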